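/- Let $d\in\mathbb N$, $\alpha\in(1,2)$, $h>0$, let $b:\mathbb R^d\to\mathbb R^d$ be continuous, and let $p$ be a probability density on $\mathbb R^d$ with mean zero such that $$0<\liminf_{r\to\infty}r^\alpha\int_{\{|x|>r\}}p(x)\,dx\le\limsup_{r\to\infty}r^\alpha\int_{\{|x|>r\}}p(x)\,dx<\infty .$$ Consider the Markov chain $X=(X_n)_{n\ge 0}$ on $\mathbb R^d$ given by $$X_{k+1}=X_k+h\,b(X_k)+Z_{k+1},\qquad k=0,1,2,\dots,$$ where $(Z_k)$ is an i.i.d. sequence with density $p$, and let $\mathbb P_x$ denote its law when $X_0=x$. (a) Suppose that $|b(x)|\le C(|x|+1)$ for all $x\in\mathbb R^d$ and some constant $C>0$, and that $h<1/(2C)$. If $\pi_h$ is an invariant probability distribution of $X$, then for every $\varepsilon>0$ there is a constant $c\in(0,\infty)$ such that $$\pi_h(\{x:|x|>r\})\ge c\,r^{-\alpha-\varepsilon}\qquad\text{for all } r\in[1,\infty).$$ In particular, $\int_{\mathbb R^d}|x|^{\alpha+\varepsilon}\,\pi_h(dx)=\infty$ for every $\varepsilon>0$. (b) If $\liminf_{|x|\to\infty}|b(x)|/|x|=\infty$,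 then $X$ is transient: $$\mathbb P_x\Bigl(\lim_{n\to\infty}|X_n|=\infty\Bigr)=1\qquad\text{for all } x\in\mathbb R^d .$$ -/

import Mathlib

open MeasureTheory ProbabilityTheory Filter

/-- The law on `ℝ^d` with Lebesgue density `p`. -/
noncomputable def densityLaw {d : ℕ} (p : EuclideanSpace ℝ (Fin d) → ℝ) :
    Measure (EuclideanSpace ℝ (Fin d)) :=
  volume.withDensity (fun x => ENNReal.ofReal (p x))

/-- `p` is a probability density on `ℝ^d` with mean zero whose tail is of exact order `r ^ (-α)`:
`0 < liminf r^α ∫_{|x|>r} p` and `limsup r^α ∫_{|x|>r} p < ∞` as `r → ∞`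
(both taken in `[0, ∞]`). -/
structure IsHeavyTailedDensity {d : ℕ} (α : ℝ) (p : EuclideanSpace ℝ (Fin d) → ℝ) : Prop where
  measurable : Measurable p
  nonneg : ∀ x, 0 ≤ p x
  integral_eq_one : ∫⁻ x, ENNReal.ofReal (p x) = 1
  integrable_mean : Integrable (fun x => p x • x)
  mean_zero : ∫ x, p x • x = 0
  liminf_pos : 0 < liminf
    (fun r : ℝ => ENNReal.ofReal (r ^ α) * ∫⁻ x in {x | r < ‖x‖}, ENNReal.ofReal (p x)) atTop
  limsup_lt_top : limsup
    (fun r : ℝ => ENNReal.ofReal (r ^ α) * ∫⁻ x in {x | r < ‖x‖}, ENNReal.ofReal (p x)) atTop < ⊤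

/-- The one-step transition kernel of the chain `X_{k+1} = X_k + h b(X_k) + Z_{k+1}`:
`P(x, ·)` is the law of `x + h b(x) + Z`, where `Z` has density `p`. -/
noncomputable def eulerKernel {d : ℕ} (h : ℝ)
    (b : EuclideanSpace ℝ (Fin d) → EuclideanSpace ℝ (Fin d)) (hb : Continuous b)
    (p : EuclideanSpace ℝ (Fin d) → ℝ) :
    Kernel (EuclideanSpace ℝ (Fin d)) (EuclideanSpace ℝ (Fin d)) where
  toFun x := (densityLaw p).map (fun z => x + h • b x + z)
  measurable' := by
    have : SFinite (densityLaw p) := by unfold densityLaw; infer_instance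
    refine Measure.measurable_of_measurable_coe _ fun s hs => ?_
    have hf : Measurable (fun q : EuclideanSpace ℝ (Fin d) × EuclideanSpace ℝ (Fin d) =>
        q.1 + h • b q.1 + q.2) := by fun_prop
    have hm := measurable_measure_prodMk_left (ν := densityLaw p) (hf hs)
    convert hm using 2 with x
    rw [Measure.map_apply (by fun_prop) hs]
    rfl

/-- On the probability space `(Ω, P)`, the process `X` is the chain started at `x` and driven by
the i.i.d. noise `Z` with density `p`: `X_0 = x` and `X_{k+1} = X_k + h b(X_k) + Z_{k+1}`
almost surely, for every `k`. -/
structure IsEulerChain {d : ℕ} {Ω : Type*} [MeasurableSpace Ω] (P : Measure Ω) (h : ℝ)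
    (b : EuclideanSpace ℝ (Fin d) → EuclideanSpace ℝ (Fin d))
    (p : EuclideanSpace ℝ (Fin d) → ℝ) (x : EuclideanSpace ℝ (Fin d))
    (Z X : ℕ → Ω → EuclideanSpace ℝ (Fin d)) : Prop where
  indep : iIndepFun Z P
  law : ∀ k, HasLaw (Z k) (densityLaw p) P
  init : ∀ᵐ ω ∂P, X 0 ω = x
  step : ∀ k, ∀ᵐ ω ∂P, X (k + 1) ω = X k ω + h • b (X k ω) + Z (k + 1) ω

/-!
Invariant distributions. The invariant law `μ` charges some ball, on which `x + h b(x)` is bounded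
by some `K`. Hence one step of the chain under `μ` exceeds `r` as soon as it starts in that ball
and the noise exceeds `r + K`, and the noise does so with probability at least a constant times
`r ^ (-α)`. So `μ` has a tail at least as heavy as that of the noise, without any loss `ε` in the
exponent (`exists_le_tail_of_invariant`), and Markov's inequality makes the moments of order
`α + ε` infinite (`lintegral_rpow_eq_top_of_le_tail`).

Transience. Under superlinear drift the map `x ↦ x + h b(x)` expands by a factor `3` outside a
large ball of radius `R`. If the chain is outside this ball and the subsequent noises are at most
`R, 2R, 4R, …`, then the chain doubles its distance to the origin at each step; since the noise is
integrable, this has probability at least `1/2` once `R` is large (`half_le_measure_tameNoise`).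
If the chain is inside the ball, a single large jump, of probability bounded below, brings it
outside. Hence the conditional probability of escape, given the noise up to any time, is bounded
below by a fixed positive constant, and Lévy's upward theorem turns this into escape with
probability one (`ae_mem_of_forall_mul_measure_le`, `ae_tendsto_norm_drivenPath`).
-/

/-! ### A zero-one law from uniform conditional lower bounds -/

/-- If the conditional probability of `A` is bounded below by a fixed `δ > 0` at every stage of
a filtration that determines `A`, then `A` has full measure: by Lévy's upward theorem the
conditional probabilities converge to the indicator of `A`, which therefore cannot vanish. -/
theorem ae_mem_of_forall_mul_measure_le {Ω : Type*} {m0 : MeasurableSpace Ω} {P : Measure Ω}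
    [IsProbabilityMeasure P] (ℱ : Filtration ℕ m0) {A : Set Ω}
    (hA : MeasurableSet[⨆ n, ℱ n] A) {δ : ENNReal} (hδ : δ ≠ 0)
    (h : ∀ n F, MeasurableSet[ℱ n] F → δ * P F ≤ P (A ∩ F)) : ∀ᵐ ω ∂P, ω ∈ A := by
  have hle : (⨆ n, ℱ n) ≤ m0 := iSup_le ℱ.le
  have hA0 : MeasurableSet A := hle _ hA
  have hδtop : δ ≠ ⊤ := by
    have h1 := (h 0 Set.univ MeasurableSet.univ).trans prob_le_one
    rw [measure_univ, mul_one] at h1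
    exact ne_top_of_le_ne_top ENNReal.one_ne_top h1
  have hδ' : 0 < δ.toReal := ENNReal.toReal_pos hδ hδtop
  set g : Ω → ℝ := A.indicator fun _ => 1 with hg
  have hgi : Integrable g P := (integrable_const (1 : ℝ)).indicator hA0
  have hbound : ∀ n, ∀ᵐ ω ∂P, δ.toReal ≤ (P[g | ℱ n]) ω := by
    intro n
    refine ae_le_of_ae_le_trim (hm := ℱ.le n) ?_
    refine ae_le_of_forall_setIntegral_le (integrable_const _)
      (integrable_condExp.trim (ℱ.le n) stronglyMeasurable_condExp) ?_
    intro F hF _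
    rw [← setIntegral_trim (ℱ.le n) stronglyMeasurable_condExp hF,
      setIntegral_condExp (ℱ.le n) hgi hF, setIntegral_const, measureReal_def,
      trim_measurableSet_eq (ℱ.le n) hF, hg, setIntegral_indicator hA0, setIntegral_const,
      measureReal_def, smul_eq_mul, smul_eq_mul, mul_one, mul_comm, ← ENNReal.toReal_mul,
      Set.inter_comm]
    exact ENNReal.toReal_mono (measure_ne_top _ _) (h n F hF)
  have hlim : P[g | ⨆ n, ℱ n] = g :=
    condExp_of_stronglyMeasurable hle (stronglyMeasurable_const.indicator hA) hgi
  filter_upwards [tendsto_ae_condExp (ℱ := ℱ) (μ := P) g, ae_all_iff.2 hbound] with ω h1 h2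
  rw [hlim] at h1
  have h3 : δ.toReal ≤ g ω := ge_of_tendsto' h1 h2
  by_contra hω
  rw [hg, Set.indicator_of_notMem hω] at h3
  exact absurd h3 (not_le.2 hδ')

/-! ### Recursions driven by additive noise -/

/-- The solution of `X₀ = x`, `X_{k+1} = f (X_k) + z_{k+1}`. The term `z₀` is not used. -/
def drivenPath {E : Type*} [Add E] (f : E → E) (x : E) (z : ℕ → E) : ℕ → E
  | 0 => x
  | n + 1 => f (drivenPath f x z n) + z (n + 1)

section Driven

variable {E : Type*} [NormedAddCommGroup E]

/-- Once the path is outside the ball of radius `R`, an expansion factor `3` minus a noise of size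
at most `2 ^ k * R` at the `k`-th step leaves growth by a factor `2` at each step. -/
theorem le_norm_drivenPath {f : E → E} {R : ℝ} (hR : 0 < R)
    (hf : ∀ y, R ≤ ‖y‖ → 3 * ‖y‖ ≤ ‖f y‖) {x : E} {z : ℕ → E} {n : ℕ}
    (hn : R ≤ ‖drivenPath f x z n‖) (hz : ∀ k, ‖z (n + k + 1)‖ ≤ 2 ^ k * R) (k : ℕ) :
    2 ^ k * R ≤ ‖drivenPath f x z (n + k)‖ := by
  induction k with
  | zero => simpa using hn
  | succ k ih =>
    have h1 : R ≤ 2 ^ k * R := le_mul_of_one_le_left hR.le (one_le_pow₀ one_le_two)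
    have h2 := hf _ (h1.trans ih)
    have h3 := norm_sub_le_norm_add (f (drivenPath f x z (n + k))) (z (n + k + 1))
    have h4 := hz k
    change _ ≤ ‖f (drivenPath f x z (n + k)) + z (n + k + 1)‖
    rw [pow_succ]
    linarith

theorem tendsto_norm_drivenPath {f : E → E} {R : ℝ} (hR : 0 < R)
    (hf : ∀ y, R ≤ ‖y‖ → 3 * ‖y‖ ≤ ‖f y‖) {x : E} {z : ℕ → E} {n : ℕ}
    (hn : R ≤ ‖drivenPath f x z n‖) (hz : ∀ k, ‖z (n + k + 1)‖ ≤ 2 ^ k * R) :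
    Tendsto (fun k => ‖drivenPath f x z k‖) atTop atTop := by
  refine (tendsto_add_atTop_iff_nat n).1 ?_
  refine tendsto_atTop_mono (fun k => ?_)
    ((tendsto_pow_atTop_atTop_of_one_lt (one_lt_two (α := ℝ))).atTop_mul_const hR)
  rw [add_comm k n]
  exact le_norm_drivenPath hR hf hn hz k

variable [MeasurableSpace E] [BorelSpace E] {Ω : Type*} {m0 : MeasurableSpace Ω}

theorem measurable_drivenPath [SecondCountableTopology E] {f : E → E} (hf : Measurable f) (x : E)
    {Z : ℕ → Ω → E} (hZ : ∀ k, StronglyMeasurable (Z k)) (n : ℕ) :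
    Measurable[Filtration.natural Z hZ n] fun ω => drivenPath f x (fun k => Z k ω) n := by
  induction n with
  | zero => exact measurable_const
  | succ n ih =>
    have h1 := ih.mono ((Filtration.natural Z hZ).mono n.le_succ) le_rfl
    have h2 : Measurable[Filtration.natural Z hZ (n + 1)] (Z (n + 1)) :=
      (Filtration.stronglyAdapted_natural hZ (n + 1)).measurable
    exact (hf.comp h1).add h2

/-- The event that, from time `n + 1` on, the noise is dominated by `R, 2R, 4R, …`. -/
def tameNoise (Z : ℕ → Ω → E) (R : ℝ) (n : ℕ) : Set Ω :=
  {ω | ∀ k, ‖Z (n + k + 1) ω‖ ≤ 2 ^ k * R}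

theorem measurableSet_tameNoise (Z : ℕ → Ω → E) (R : ℝ) (n : ℕ) :
    MeasurableSet[⨆ i ∈ Set.Ioi n, MeasurableSpace.comap (Z i) inferInstance]
      (tameNoise Z R n) := by
  have : tameNoise Z R n = ⋂ k, Z (n + k + 1) ⁻¹' {y | ‖y‖ ≤ 2 ^ k * R} := by
    ext; simp [tameNoise]
  rw [this]
  refine MeasurableSet.iInter fun k => ?_
  refine le_iSup₂ (f := fun i (_ : i ∈ Set.Ioi n) => MeasurableSpace.comap (Z i) inferInstance)
    (n + k + 1) (Set.mem_Ioi.2 (by lia)) _ ⟨_, ?_, rfl⟩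
  exact measurableSet_le measurable_norm measurable_const

/-- Markov's inequality at each time and a geometric sum bound the probability of the complement
of `tameNoise Z R n` by `2 * 𝔼‖Z‖ / R`. -/
theorem half_le_measure_tameNoise {P : Measure Ω} [IsProbabilityMeasure P] {Z : ℕ → Ω → E}
    (hZ : ∀ k, Measurable (Z k)) {I : NNReal} (hI : ∀ k, ∫⁻ ω, ‖Z k ω‖ₑ ∂P ≤ I) {R : NNReal}
    (hR : 0 < R) (hIR : 4 * I ≤ R) (n : ℕ) : 2⁻¹ ≤ P (tameNoise Z R n) := by
  have hterm : ∀ k, P {ω | 2 ^ k * (R : ℝ) < ‖Z (n + k + 1) ω‖} ≤ 4⁻¹ * 2⁻¹ ^ k := by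
    intro k
    have h1 : P {ω | 2 ^ k * (R : ℝ) < ‖Z (n + k + 1) ω‖} ≤
        P {ω | ((2 ^ k * R : NNReal) : ENNReal) ≤ ‖Z (n + k + 1) ω‖ₑ} := by
      refine measure_mono fun ω hω => ?_
      have : (2 ^ k * R : NNReal) ≤ ‖Z (n + k + 1) ω‖₊ := by
        rw [← NNReal.coe_le_coe]; push_cast; exact le_of_lt hω
      exact ENNReal.coe_le_coe.2 this
    have h2 := (mul_meas_ge_le_lintegral₀ (hZ (n + k + 1)).enorm.aemeasurable
      ((2 ^ k * R : NNReal) : ENNReal) (μ := P)).trans (hI _)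
    have h3 : ((2 ^ k * R : NNReal) : ENNReal) ≠ 0 := by simp [hR.ne']
    refine h1.trans ?_
    rw [mul_comm, ← ENNReal.le_div_iff_mul_le (Or.inl h3) (Or.inl ENNReal.coe_ne_top)] at h2
    refine h2.trans (ENNReal.div_le_of_le_mul ?_)
    have h4 : (I : NNReal) ≤ 4⁻¹ * 2⁻¹ ^ k * (2 ^ k * R) := by
      have : (4⁻¹ * 2⁻¹ ^ k * (2 ^ k * R) : NNReal) = 4⁻¹ * R := by
        rw [inv_pow]; field_simp
      rw [this, le_inv_mul_iff₀ (by norm_num)]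
      exact hIR
    have h5 := ENNReal.coe_le_coe.2 h4
    push_cast at h5
    rwa [ENNReal.coe_mul]
  have hcompl : P (tameNoise Z R n)ᶜ ≤ 2⁻¹ := by
    have h1 : (tameNoise Z R n)ᶜ = ⋃ k, {ω | 2 ^ k * (R : ℝ) < ‖Z (n + k + 1) ω‖} := by
      ext; simp [tameNoise]
    rw [h1]
    refine (measure_iUnion_le _).trans ((ENNReal.tsum_le_tsum hterm).trans ?_)
    rw [ENNReal.tsum_mul_left, ENNReal.tsum_geometric, ENNReal.one_sub_inv_two, inv_inv,
      show (4 : ENNReal) = 2 * 2 by norm_num, ENNReal.mul_inv (by simp) (by simp), mul_assoc,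
      ENNReal.inv_mul_cancel (by simp) (by simp), mul_one]
  have hmeas : MeasurableSet (tameNoise Z R n) :=
    (iSup₂_le fun i _ => (hZ i).comap_le) _ (measurableSet_tameNoise Z R n)
  have h2 := prob_add_prob_compl (μ := P) hmeas
  have h3 : (1 : ENNReal) ≤ P (tameNoise Z R n) + 2⁻¹ := by
    rw [← h2]; gcongr
  rwa [← ENNReal.inv_two_add_inv_two, ENNReal.add_le_add_iff_right (by simp)] at h3

/-- **Transience of an expanding recursion with independent noise.** If `f` expands by a factor
`3` far out, the noise has bounded first moments and exceeds every level with a probability that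
is bounded below in time, then the path escapes to infinity almost surely. -/
theorem ae_tendsto_norm_drivenPath [ProperSpace E] {P : Measure Ω} [IsProbabilityMeasure P]
    {f : E → E} (hf : Continuous f)
    {R₀ : ℝ} (hexp : ∀ y, R₀ ≤ ‖y‖ → 3 * ‖y‖ ≤ ‖f y‖) (x : E) {Z : ℕ → Ω → E}
    (hZ : ∀ k, Measurable (Z k)) (hindep : iIndepFun Z P)
    {I : NNReal} (hI : ∀ k, ∫⁻ ω, ‖Z k ω‖ₑ ∂P ≤ I)
    (htail : ∀ r : ℝ, ∃ q : ENNReal, q ≠ 0 ∧ ∀ k, q ≤ P {ω | r < ‖Z k ω‖}) :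
    ∀ᵐ ω ∂P, Tendsto (fun n => ‖drivenPath f x (fun k => Z k ω) n‖) atTop atTop := by
  have hZs : ∀ k, StronglyMeasurable (Z k) := fun k => (hZ k).stronglyMeasurable
  set ℱ := Filtration.natural Z hZs with hℱ
  set R : NNReal := max 1 (max R₀.toNNReal (4 * I)) with hRdef
  have hR : 0 < R := lt_of_lt_of_le one_pos (le_max_left _ _)
  have hR0 : (0 : ℝ) < R := hR
  have hR₀ : R₀ ≤ R := (Real.le_coe_toNNReal R₀).trans
    (NNReal.coe_le_coe.2 ((le_max_left _ _).trans (le_max_right _ _)))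
  have hIR : 4 * I ≤ R := (le_max_right _ _).trans (le_max_right _ _)
  have hexp' : ∀ y, (R : ℝ) ≤ ‖y‖ → 3 * ‖y‖ ≤ ‖f y‖ := fun y hy => hexp y (hR₀.trans hy)
  obtain ⟨K, hK⟩ := (isCompact_closedBall (0 : E) (R : ℝ)).exists_bound_of_continuousOn
    hf.continuousOn
  obtain ⟨q, hq0, hq⟩ := htail (R + K)
  have hq1 : q ≤ 1 := (hq 0).trans prob_le_one
  set A : Set Ω := {ω | Tendsto (fun n => ‖drivenPath f x (fun k => Z k ω) n‖) atTop atTop}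
  have hpast : ∀ n s t, MeasurableSet[ℱ n] s →
      MeasurableSet[⨆ i ∈ Set.Ioi n, MeasurableSpace.comap (Z i) inferInstance] t →
      P (s ∩ t) = P s * P t := fun n => (Indep_iff _ _ _).1
    (indep_iSup_of_disjoint (fun i => (hZ i).comap_le) hindep.iIndep
      (Set.Iic_disjoint_Ioi (le_refl n)))
  have hhalf : ∀ n, 2⁻¹ ≤ P (tameNoise Z R n) := half_le_measure_tameNoise hZ hI hR hIR
  refine ae_mem_of_forall_mul_measure_le ℱ (A := A) (δ := q * 2⁻¹) ?_ (by simp [hq0]) ?_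
  · exact @measurableSet_tendsto _ _ _ (⨆ n, ℱ n) _ _ _ _ _ _ _ _ fun n =>
      measurable_norm.comp
        ((measurable_drivenPath hf.measurable x hZs n).mono (le_iSup (fun n => ℱ n) n) le_rfl)
  intro n F hF
  set B : Set Ω := {ω | (R : ℝ) ≤ ‖drivenPath f x (fun k => Z k ω) n‖} with hBdef
  have hB : MeasurableSet[ℱ n] B :=
    measurable_drivenPath hf.measurable x hZs n
      (measurableSet_le measurable_const measurable_norm : MeasurableSet {y : E | (R : ℝ) ≤ ‖y‖})
  -- Outside the ball, tame noise from time `n + 1` on suffices for escape.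
  have hout : q * 2⁻¹ * P (F ∩ B) ≤ P (A ∩ (F ∩ B)) := calc
    q * 2⁻¹ * P (F ∩ B) ≤ 1 * P (tameNoise Z R n) * P (F ∩ B) := by
      gcongr; exact hhalf n
    _ = P ((F ∩ B) ∩ tameNoise Z R n) := by
      rw [hpast n _ _ (hF.inter hB) (measurableSet_tameNoise Z R n), one_mul, mul_comm]
    _ ≤ P (A ∩ (F ∩ B)) := measure_mono fun ω hω =>
      ⟨tendsto_norm_drivenPath hR0 hexp' hω.1.2 hω.2, hω.1⟩
  -- Inside the ball, one jump larger than `R + K` leaves it, and tame noise from time `n + 2` on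
  -- then suffices.
  set J : Set Ω := {ω | (R : ℝ) + K < ‖Z (n + 1) ω‖} with hJdef
  have hJset : MeasurableSet {y : E | (R : ℝ) + K < ‖y‖} :=
    measurableSet_lt measurable_const measurable_norm
  have hJpast : MeasurableSet[ℱ (n + 1)] J :=
    (Filtration.stronglyAdapted_natural hZs (n + 1)).measurable hJset
  have hJfut : MeasurableSet[⨆ i ∈ Set.Ioi n, MeasurableSpace.comap (Z i) inferInstance] J :=
    le_iSup₂ (f := fun i (_ : i ∈ Set.Ioi n) => MeasurableSpace.comap (Z i) inferInstance)
      (n + 1) (Set.mem_Ioi.2 n.lt_succ_self) _ ⟨_, hJset, rfl⟩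
  have hin : q * 2⁻¹ * P (F ∩ Bᶜ) ≤ P (A ∩ (F ∩ Bᶜ)) := calc
    q * 2⁻¹ * P (F ∩ Bᶜ) ≤ P J * P (tameNoise Z R (n + 1)) * P (F ∩ Bᶜ) := by
      gcongr
      · exact hq _
      · exact hhalf _
    _ = P (((F ∩ Bᶜ) ∩ J) ∩ tameNoise Z R (n + 1)) := by
      rw [hpast (n + 1) _ _ ((ℱ.mono n.le_succ _ (hF.inter hB.compl)).inter hJpast)
        (measurableSet_tameNoise Z R (n + 1)), hpast n _ _ (hF.inter hB.compl) hJfut]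
      ring
    _ ≤ P (A ∩ (F ∩ Bᶜ)) := by
      refine measure_mono fun ω hω => ⟨?_, hω.1.1⟩
      refine tendsto_norm_drivenPath hR0 hexp' (n := n + 1) ?_ hω.2
      have h1 : ‖drivenPath f x (fun k => Z k ω) n‖ ≤ R := (lt_of_not_ge fun h => hω.1.1.2 h).le
      have h2 := hK _ (mem_closedBall_zero_iff.2 h1)
      have h3 : (R : ℝ) + K < ‖Z (n + 1) ω‖ := hω.1.2
      have h4 := norm_sub_le_norm_add (Z (n + 1) ω) (f (drivenPath f x (fun k => Z k ω) n))
      change (R : ℝ) ≤ ‖f (drivenPath f x (fun k => Z k ω) n) + Z (n + 1) ω‖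
      rw [add_comm]
      linarith
  have hB0 : MeasurableSet B := ℱ.le n _ hB
  rw [← measure_inter_add_sdiff F hB0, ← measure_inter_add_sdiff (A ∩ F) hB0, mul_add,
    Set.inter_assoc, Set.sdiff_eq, Set.sdiff_eq, Set.inter_assoc]
  exact add_le_add hout hin

end Driven

/-! ### The noise law -/

section Law

variable {d : ℕ} {α : ℝ} {p : EuclideanSpace ℝ (Fin d) → ℝ}

theorem IsHeavyTailedDensity.isProbabilityMeasure (hp : IsHeavyTailedDensity α p) :
    IsProbabilityMeasure (densityLaw p) :=
  ⟨by rw [densityLaw, withDensity_apply _ MeasurableSet.univ, setLIntegral_univ,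
    hp.integral_eq_one]⟩

theorem measurableSet_lt_norm (d : ℕ) (r : ℝ) :
    MeasurableSet {x : EuclideanSpace ℝ (Fin d) | r < ‖x‖} :=
  measurableSet_lt measurable_const measurable_norm

/-- The lower tail bound holds from `r = 1` on, not only eventually, since the tail is
nonincreasing. -/
theorem IsHeavyTailedDensity.exists_le_tail (hα : 0 < α) (hp : IsHeavyTailedDensity α p) :
    ∃ c : ℝ, 0 < c ∧ ∀ r : ℝ, 1 ≤ r →
      ENNReal.ofReal (c * r ^ (-α)) ≤ densityLaw p {z | r < ‖z‖} := by
  obtain ⟨c₀, hc₀, hc₀'⟩ := ENNReal.lt_iff_exists_nnreal_btwn.1 hp.liminf_pos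
  have hev := eventually_lt_of_lt_liminf hc₀'
  have hc₀pos : (0 : ℝ) < c₀ := by exact_mod_cast hc₀
  obtain ⟨R, hR⟩ := eventually_atTop.1 hev
  have hlarge : ∀ r, R ≤ r → 1 ≤ r →
      ENNReal.ofReal (c₀ * r ^ (-α)) ≤ densityLaw p {z | r < ‖z‖} := by
    intro r hr hr1
    have hr0 : 0 < r := one_pos.trans_le hr1
    have h1 := (hR r hr).le
    have h2 : ENNReal.ofReal (r ^ (-α)) * ENNReal.ofReal (r ^ α) = 1 := by
      rw [← ENNReal.ofReal_mul (by positivity), ← Real.rpow_add hr0, neg_add_cancel,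
        Real.rpow_zero, ENNReal.ofReal_one]
    rw [densityLaw, withDensity_apply _ (measurableSet_lt_norm d r)]
    calc ENNReal.ofReal (c₀ * r ^ (-α))
        = ENNReal.ofReal (r ^ (-α)) * c₀ := by
          rw [mul_comm, ENNReal.ofReal_mul (by positivity), ENNReal.ofReal_coe_nnreal]
      _ ≤ ENNReal.ofReal (r ^ (-α)) * (ENNReal.ofReal (r ^ α) *
            ∫⁻ x in {x | r < ‖x‖}, ENNReal.ofReal (p x)) := by gcongr
      _ = _ := by rw [← mul_assoc, h2, one_mul]
  set S := max R 1 with hS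
  have hS1 : 1 ≤ S := le_max_right _ _
  have hS0 : 0 < S := one_pos.trans_le hS1
  refine ⟨c₀ * S ^ (-α), by positivity, fun r hr => ?_⟩
  have hr0 : 0 < r := one_pos.trans_le hr
  rcases le_total S r with h | h
  · refine le_trans (ENNReal.ofReal_le_ofReal ?_) (hlarge r ((le_max_left _ _).trans h) hr)
    gcongr
    exact mul_le_of_le_one_right hc₀pos.le
      (Real.rpow_le_one_of_one_le_of_nonpos hS1 (neg_nonpos.2 hα.le))
  · refine (le_trans (ENNReal.ofReal_le_ofReal ?_) (hlarge S (le_max_left _ _) hS1)).trans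
      (measure_mono fun z hz => lt_of_le_of_lt h hz)
    exact mul_le_of_le_one_right (by positivity)
      (Real.rpow_le_one_of_one_le_of_nonpos hr (neg_nonpos.2 hα.le))

theorem IsHeavyTailedDensity.lintegral_enorm_lt_top (hp : IsHeavyTailedDensity α p) :
    ∫⁻ z, ‖z‖ₑ ∂(densityLaw p) < ⊤ := by
  rw [densityLaw, lintegral_withDensity_eq_lintegral_mul _ hp.measurable.ennreal_ofReal
    measurable_enorm]
  refine lt_of_eq_of_lt (lintegral_congr fun z => ?_) hp.integrable_mean.2
  rw [enorm_smul, Real.enorm_of_nonneg (hp.nonneg z), Pi.mul_apply]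

end Law

/-! ### Invariant distributions inherit the tail of the noise -/

section Invariant

variable {d : ℕ} {α h : ℝ} {b : EuclideanSpace ℝ (Fin d) → EuclideanSpace ℝ (Fin d)}
  {hb : Continuous b} {p : EuclideanSpace ℝ (Fin d) → ℝ} {μ : Measure (EuclideanSpace ℝ (Fin d))}

theorem eulerKernel_apply (x : EuclideanSpace ℝ (Fin d)) :
    eulerKernel h b hb p x = (densityLaw p).map (fun z => x + h • b x + z) := rfl

/-- The invariant law charges some ball, and from any point of that ball a single jump of the
noise of size `r + K` leads beyond radius `r`, where `K` bounds `x + h b(x)` on the ball. -/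
theorem exists_le_tail_of_invariant (hα : 0 < α) (hp : IsHeavyTailedDensity α p)
    [IsProbabilityMeasure μ] (hμ : Kernel.Invariant (eulerKernel h b hb p) μ) :
    ∃ c : ℝ, 0 < c ∧ ∀ r : ℝ, 1 ≤ r → c * r ^ (-α) ≤ μ.real {x | r < ‖x‖} := by
  obtain ⟨c, hc, htail⟩ := hp.exists_le_tail hα
  obtain ⟨M, hM⟩ : ∃ M : ℕ, μ (Metric.closedBall 0 M) ≠ 0 := by
    by_contra! hcon
    have h1 := measure_iUnion_null hcon
    rw [Metric.iUnion_closedBall_nat, measure_univ] at h1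
    exact one_ne_zero h1
  have hcont : Continuous fun x => x + h • b x := by fun_prop
  obtain ⟨K₀, hK₀⟩ := (isCompact_closedBall (0 : EuclideanSpace ℝ (Fin d)) (M : ℝ)
    ).exists_bound_of_continuousOn hcont.continuousOn
  set K := max K₀ 0
  have hK0 : 0 ≤ K := le_max_right _ _
  have hK : ∀ x ∈ Metric.closedBall 0 (M : ℝ), ‖x + h • b x‖ ≤ K :=
    fun x hx => (hK₀ x hx).trans (le_max_left _ _)
  have hMpos : 0 < μ.real (Metric.closedBall 0 M) :=
    ENNReal.toReal_pos hM (measure_ne_top _ _)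
  refine ⟨c * (1 + K) ^ (-α) * μ.real (Metric.closedBall 0 M), by positivity, fun r hr => ?_⟩
  have hr0 : 0 < r := one_pos.trans_le hr
  have hstep : ENNReal.ofReal (c * (r + K) ^ (-α)) * μ (Metric.closedBall 0 M) ≤
      μ {x | r < ‖x‖} := calc
    ENNReal.ofReal (c * (r + K) ^ (-α)) * μ (Metric.closedBall 0 M)
        = ∫⁻ _ in Metric.closedBall 0 (M : ℝ), ENNReal.ofReal (c * (r + K) ^ (-α)) ∂μ := by
          rw [setLIntegral_const]
    _ ≤ ∫⁻ x in Metric.closedBall 0 (M : ℝ), eulerKernel h b hb p x {y | r < ‖y‖} ∂μ := by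
          refine setLIntegral_mono' measurableSet_closedBall fun x hx => ?_
          rw [eulerKernel_apply, Measure.map_apply (by fun_prop) (measurableSet_lt_norm d r)]
          refine (htail (r + K) (by linarith)).trans (measure_mono fun z hz => ?_)
          have h1 : r + K < ‖z‖ := hz
          have h2 := norm_sub_le_norm_add z (x + h • b x)
          have h3 := hK x hx
          change r < ‖x + h • b x + z‖
          rw [add_comm]
          linarith
    _ ≤ ∫⁻ x, eulerKernel h b hb p x {y | r < ‖y‖} ∂μ := setLIntegral_le_lintegral _ _
    _ = μ {x | r < ‖x‖} := by
          rw [← Measure.bind_apply (measurableSet_lt_norm d r) (Kernel.aemeasurable _)]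
          exact congrArg (fun ν : Measure _ => ν {x | r < ‖x‖}) hμ
  have hreal := ENNReal.toReal_mono (measure_ne_top _ _) hstep
  rw [ENNReal.toReal_mul, ENNReal.toReal_ofReal (by positivity)] at hreal
  refine le_trans ?_ hreal
  have h1 : (1 + K) ^ (-α) * r ^ (-α) ≤ (r + K) ^ (-α) := by
    rw [← Real.mul_rpow (by positivity) hr0.le]
    refine Real.rpow_le_rpow_of_nonpos (by positivity) ?_ (neg_nonpos.2 hα.le)
    nlinarith
  calc c * (1 + K) ^ (-α) * μ.real (Metric.closedBall 0 M) * r ^ (-α)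
      = c * ((1 + K) ^ (-α) * r ^ (-α)) * μ.real (Metric.closedBall 0 M) := by ring
    _ ≤ c * (r + K) ^ (-α) * μ.real (Metric.closedBall 0 M) := by gcongr

/-- By Markov's inequality a finite moment of order `α + ε` would force `c * r ^ ε` to stay
bounded. -/
theorem lintegral_rpow_eq_top_of_le_tail {c : ℝ} (hc : 0 < c) [IsFiniteMeasure μ] (hα : 0 < α)
    (htail : ∀ r : ℝ, 1 ≤ r → c * r ^ (-α) ≤ μ.real {x | r < ‖x‖}) {ε : ℝ} (hε : 0 < ε) :
    ∫⁻ x, ENNReal.ofReal (‖x‖ ^ (α + ε)) ∂μ = ⊤ := by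
  by_contra hfin
  set I := ∫⁻ x, ENNReal.ofReal (‖x‖ ^ (α + ε)) ∂μ with hI
  have hbound : ∀ r : ℝ, 1 ≤ r → c * r ^ ε ≤ I.toReal := by
    intro r hr
    have hr0 : 0 < r := one_pos.trans_le hr
    have h1 : ENNReal.ofReal (r ^ (α + ε)) * μ {x | r < ‖x‖} ≤ I := by
      refine le_trans ?_ (mul_meas_ge_le_lintegral₀ (by fun_prop) (ENNReal.ofReal (r ^ (α + ε))))
      gcongr with x
      intro hx
      gcongr
    have h2 := ENNReal.toReal_mono hfin h1
    rw [ENNReal.toReal_mul, ENNReal.toReal_ofReal (by positivity)] at h2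
    refine le_trans ?_ h2
    calc c * r ^ ε = r ^ (α + ε) * (c * r ^ (-α)) := by
          rw [Real.rpow_add hr0, Real.rpow_neg hr0.le]
          field_simp
      _ ≤ _ := by gcongr; exact htail r hr
  have hlim : Tendsto (fun r : ℝ => c * r ^ ε) atTop atTop :=
    (tendsto_rpow_atTop hε).const_mul_atTop hc
  obtain ⟨r, hr1, hr2⟩ := ((eventually_ge_atTop 1).and (hlim.eventually_gt_atTop I.toReal)).exists
  exact absurd (hbound r hr1) (not_le.2 hr2)

end Invariant

/-! ### Transience under superlinear drift -/

section Transience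

variable {d : ℕ} {α h : ℝ} {b : EuclideanSpace ℝ (Fin d) → EuclideanSpace ℝ (Fin d)}
  {p : EuclideanSpace ℝ (Fin d) → ℝ}

/-- A superlinear drift, whatever its direction, makes `x + h b(x)` at least three times as long
as `x` far out. -/
theorem exists_three_mul_norm_le (hh : 0 < h)
    (hlim : liminf (fun x => ENNReal.ofReal (‖b x‖ / ‖x‖))
      (Bornology.cobounded (EuclideanSpace ℝ (Fin d))) = ⊤) :
    ∃ R : ℝ, ∀ y, R ≤ ‖y‖ → 3 * ‖y‖ ≤ ‖y + h • b y‖ := by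
  have hev := eventually_lt_of_lt_liminf (hlim ▸ ENNReal.ofReal_lt_top :
    ENNReal.ofReal (4 / h) < liminf (fun x => ENNReal.ofReal (‖b x‖ / ‖x‖)) _)
  obtain ⟨R, -, hR⟩ := hasBasis_cobounded_norm.eventually_iff.1 hev
  refine ⟨max R 1, fun y hy => ?_⟩
  have hy0 : 0 < ‖y‖ := one_pos.trans_le ((le_max_right _ _).trans hy)
  have h1 := (ENNReal.ofReal_lt_ofReal_iff_of_nonneg (by positivity)).1
    (hR (show R ≤ ‖y‖ from (le_max_left _ _).trans hy))
  rw [div_lt_div_iff₀ hh hy0] at h1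
  have h2 := norm_sub_le_norm_add (h • b y) y
  rw [norm_smul, Real.norm_of_nonneg hh.le] at h2
  rw [add_comm]
  linarith

/-- The chain agrees almost surely with the path driven by any modification of its noise. -/
theorem IsEulerChain.ae_eq_drivenPath {Ω : Type*} [MeasurableSpace Ω] {P : Measure Ω}
    {x : EuclideanSpace ℝ (Fin d)} {Z X Z' : ℕ → Ω → EuclideanSpace ℝ (Fin d)}
    (hX : IsEulerChain P h b p x Z X) (hZ' : ∀ k, Z k =ᵐ[P] Z' k) :
    ∀ᵐ ω ∂P, ∀ n, X n ω = drivenPath (fun y => y + h • b y) x (fun k => Z' k ω) n := by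
  filter_upwards [hX.init, ae_all_iff.2 hX.step, ae_all_iff.2 hZ'] with ω h0 hs hz n
  induction n with
  | zero => exact h0
  | succ n ih => rw [hs n, ih, hz (n + 1)]; rfl

/-- The measurable modification `Z'` of the noise is needed because `Z` is only almost everywhere
measurable, while the filtration it generates must consist of measurable sets. -/
theorem IsEulerChain.ae_tendsto_norm (hα : 0 < α) (hh : 0 < h) (hb : Continuous b)
    (hp : IsHeavyTailedDensity α p)
    (hlim : liminf (fun x => ENNReal.ofReal (‖b x‖ / ‖x‖))
      (Bornology.cobounded (EuclideanSpace ℝ (Fin d))) = ⊤)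
    {Ω : Type*} [MeasurableSpace Ω] {P : Measure Ω} [IsProbabilityMeasure P]
    {x : EuclideanSpace ℝ (Fin d)} {Z X : ℕ → Ω → EuclideanSpace ℝ (Fin d)}
    (hX : IsEulerChain P h b p x Z X) : ∀ᵐ ω ∂P, Tendsto (fun n => ‖X n ω‖) atTop atTop := by
  set Z' : ℕ → Ω → EuclideanSpace ℝ (Fin d) := fun k => (hX.law k).aemeasurable.mk (Z k)
  have hZ' : ∀ k, Z k =ᵐ[P] Z' k := fun k => (hX.law k).aemeasurable.ae_eq_mk
  have hmeas : ∀ k, Measurable (Z' k) := fun k => (hX.law k).aemeasurable.measurable_mk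
  have hmap : ∀ k, P.map (Z' k) = densityLaw p := fun k => by
    rw [← Measure.map_congr (hZ' k), (hX.law k).map_eq]
  obtain ⟨R, hR⟩ := exists_three_mul_norm_le hh hlim
  obtain ⟨c, hc, htail⟩ := hp.exists_le_tail hα
  have hmoment : ∀ k, ∫⁻ ω, ‖Z' k ω‖ₑ ∂P ≤ (∫⁻ z, ‖z‖ₑ ∂(densityLaw p)).toNNReal := fun k => by
    rw [ENNReal.coe_toNNReal hp.lintegral_enorm_lt_top.ne, ← hmap k,
      lintegral_map measurable_enorm (hmeas k)]
  have hbig : ∀ r : ℝ, ∃ q : ENNReal, q ≠ 0 ∧ ∀ k, q ≤ P {ω | r < ‖Z' k ω‖} := fun r => by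
    refine ⟨densityLaw p {z | r < ‖z‖}, ?_, fun k => ?_⟩
    · have h1 : 0 < max r 1 := one_pos.trans_le (le_max_right _ _)
      refine ((ENNReal.ofReal_pos.2 (by positivity)).trans_le
        ((htail (max r 1) (le_max_right _ _)).trans (measure_mono fun z hz => ?_))).ne'
      exact (le_max_left r 1).trans_lt hz
    · rw [← hmap k, Measure.map_apply (hmeas k) (measurableSet_lt_norm d r)]
      rfl
  filter_upwards [hX.ae_eq_drivenPath hZ', ae_tendsto_norm_drivenPath
    (f := fun y => y + h • b y) (by fun_prop) hR x hmeas (hX.indep.congr hZ') hmoment hbig]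
    with ω h1 h2
  simpa only [h1] using h2

end Transience

theorem mainTheorem10 (d : ℕ) (α h : ℝ) (hα₁ : 1 < α) (hα₂ : α < 2) (hh : 0 < h)
    (b : EuclideanSpace ℝ (Fin d) → EuclideanSpace ℝ (Fin d)) (hb : Continuous b)
    (p : EuclideanSpace ℝ (Fin d) → ℝ) (hp : IsHeavyTailedDensity α p) :
    (∀ C : ℝ, 0 < C → (∀ x, ‖b x‖ ≤ C * (‖x‖ + 1)) → h < 1 / (2 * C) →
      ∀ μ : Measure (EuclideanSpace ℝ (Fin d)), IsProbabilityMeasure μ →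
        Kernel.Invariant (eulerKernel h b hb p) μ →
        (∀ ε : ℝ, 0 < ε → ∃ c : ℝ, 0 < c ∧
          ∀ r : ℝ, 1 ≤ r → c * r ^ (-α - ε) ≤ μ.real {x | r < ‖x‖}) ∧
        (∀ ε : ℝ, 0 < ε → ∫⁻ x, ENNReal.ofReal (‖x‖ ^ (α + ε)) ∂μ = ⊤)) ∧
    (liminf (fun x => ENNReal.ofReal (‖b x‖ / ‖x‖))
        (Bornology.cobounded (EuclideanSpace ℝ (Fin d))) = ⊤ →
      ∀ (Ω : Type*) [MeasurableSpace Ω] (P : Measure Ω) [IsProbabilityMeasure P]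
        (x : EuclideanSpace ℝ (Fin d)) (Z X : ℕ → Ω → EuclideanSpace ℝ (Fin d)),
        IsEulerChain P h b p x Z X →
        ∀ᵐ ω ∂P, Tendsto (fun n => ‖X n ω‖) atTop atTop) := by
  have hα : 0 < α := one_pos.trans hα₁
  refine ⟨fun C _ _ _ μ _ hμ => ?_, fun hlim Ω _ P _ x Z X hX =>
    hX.ae_tendsto_norm hα hh hb hp hlim⟩
  obtain ⟨c, hc, htail⟩ := exists_le_tail_of_invariant hα hp hμ
  refine ⟨fun ε hε => ⟨c, hc, fun r hr => le_trans ?_ (htail r hr)⟩,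
    fun ε hε => lintegral_rpow_eq_top_of_le_tail hc hα htail hε⟩
  gcongr
  linarith
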